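/- Let $p$ be a prime, $m\ge 1$, $q=p^m$, and let $\gamma$ be a generator of $\mathbb F_{q^2}^*$. Let $h,\Delta$ be positive integers with $h\not\equiv 0\pmod{q+1}$ and $\gcd(\Delta,q-1)=1$, and put $e=\gcd(h,q+1)$. Let $\mathrm{Tr}_q,\mathrm{Tr}_{q^2}$ be the trace maps from $\mathbb F_q,\mathbb F_{q^2}$ to $\mathbb F_p$. Put $B_j=q^{-1}(q-1)^j+(-1)^j(1-q^{-1})$, $N_0=1$, $N_1=0$ and, for $r\ge 2$, $$N_r=r!\,e^r\sum_{\substack{\lambda_2,\lambda_3,\ldots\ge 0\\ \sum_{j\ge2} j\lambda_j=r}}\binom{\frac{q+1}{e}}{\sum_j\lambda_j}\Bigl(\sum_j\lambda_j\Bigr)!\prod_{j}\frac{(B_j/j!)^{\lambda_j}}{\lambda_j!}.$$ For $n\ge 1$ let $M_n=\bigl[(jeq-q-1)^i\bigr]_{0\le i,j\le n-1}$. (i) Let $p=2$, let $0\le t\le\frac{q+1}{2e}$, and let $d_0,\ldots,d_t$ be integers with $d_j\equiv s_j(q-1)+\Delta\pmod{q^2-1}$, where $s_j\equiv jh+\frac{\Delta}{2}\pmod{q+1}$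 (division by $2$ modulo the odd number $q+1$). Let $\mathcal C^{(1)}$ be the set of all words $\bigl(\mathrm{Tr}_q(a_0\gamma^{d_0i})+\mathrm{Tr}_{q^2}(\sum_{j=1}^t a_j\gamma^{d_ji})\bigr)_{i=0}^{q^2-2}$ with $a_0\in\mathbb F_q$ and $a_1,\ldots,a_t\in\mathbb F_{q^2}$. For $0\le j\le 2t$ let $\mu_j$ be the number of words of Hamming weight $w_j=\frac{q^2-(je-1)q}{2}$ in $\mathcal C^{(1)}$, let $\mu=(\mu_0,\ldots,\mu_{2t})^T$ and $b=(b_0,\ldots,b_{2t})^T$ with $b_i=q^{2t+1}N_i-(q^2-1)^i$. Then $M_{2t+1}$ is invertible and $\mu=M_{2t+1}^{-1}b$. Moreover, for $0\le r\le 2t+1$, $N_r$ is the number of $(x_1,\ldots,x_r)\in(\mathbb F_{q^2}^*)^r$ with $x_1^{d_j}+\cdots+x_r^{d_j}=0$ for all $0\le j\le t$. (ii) Let $p$ be any prime, let $1\le t\le\frac{q+1}{2e}$, assume that $h$ is odd if $p$ is odd, and let $\tilde d_1,\ldots,\tilde d_t$ be integers with $\tilde d_j\equiv\tilde s_j(q-1)+\Delta\pmod{q^2-1}$,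 where $\tilde s_j\equiv jh+\frac{\Delta-h}{2}\pmod{q+1}$ (for $p=2$ division by $2$ is modulo $q+1$; for odd $p$, $\Delta-h$ is even and $\frac{\Delta-h}{2}$ is an integer). Let $\mathcal C^{(2)}$ be the set of all words $\bigl(\mathrm{Tr}_{q^2}(\sum_{j=1}^t a_j\gamma^{\tilde d_ji})\bigr)_{i=0}^{q^2-2}$ with $a_1,\ldots,a_t\in\mathbb F_{q^2}$. For $0\le j\le 2t-1$ let $\tilde\mu_j$ be the number of words of Hamming weight $\tilde w_j=\frac{p-1}{p}\bigl(q^2-(je-1)q\bigr)$ in $\mathcal C^{(2)}$, let $\tilde\mu=(\tilde\mu_0,\ldots,\tilde\mu_{2t-1})^T$ and $\tilde b=(\tilde b_0,\ldots,\tilde b_{2t-1})^T$ with $\tilde b_i=q^{2t}N_i-(q^2-1)^i$. Then $M_{2t}$ is invertible and $\tilde\mu=M_{2t}^{-1}\tilde b$. Moreover, for $0\le r\le 2t$, $N_r$ is the number of $(x_1,\ldots,x_r)\in(\mathbb F_{q^2}^*)^r$ with $x_1^{\tilde d_j}+\cdots+x_r^{\tilde d_j}=0$ for all $1\le j\le t$.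 -/

import Mathlib

/-- The set `{(c_i)_{i=0}^{q^2-2}}` of words
`c_i = Tr_q (a_0 γ ^ (d_0 i)) + Tr_{q^2} (∑_{j=1}^t a_j γ ^ (d_j i))` over `𝔽_p`, where `a_0` runs
through `L = 𝔽_q`, the `a_j` with `1 ≤ j ≤ t` run through `K = 𝔽_{q^2}`, and `Tr_q`, `Tr_{q^2}` are
the traces to `𝔽_p`.  The element `y` of `L` is the product `a_0 γ ^ (d_0 i)`; it exists for every
`a_0` and `i` as soon as `q + 1` divides `d_0`, which the choice of the exponents guarantees. -/
def nihoCodeOne (p q : ℕ) (L K : Type*) [Field L] [Field K] [Algebra L K]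
    [Algebra (ZMod p) L] [Algebra (ZMod p) K] (γ : Kˣ) {t : ℕ} (d : Fin (t + 1) → ℤ) :
    Set (Fin (q ^ 2 - 1) → ZMod p) :=
  {c | ∃ (a₀ : L) (a : Fin t → K), ∀ i : Fin (q ^ 2 - 1),
    ∃ y : L, algebraMap L K y = algebraMap L K a₀ * ((γ ^ (d 0 * (i : ℤ)) : Kˣ) : K) ∧
      c i = Algebra.trace (ZMod p) L y +
        Algebra.trace (ZMod p) K (∑ j : Fin t, a j * ((γ ^ (d j.succ * (i : ℤ)) : Kˣ) : K))}

/-- The set of words `c_i = Tr_{q^2} (∑_{j=1}^t a_j γ ^ (d_j i))`, `0 ≤ i ≤ q^2 - 2`, over `𝔽_p`,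
where the `a_j` run through `K = 𝔽_{q^2}`.  The exponents `d_1, …, d_t` are `d 0, …, d (t - 1)`. -/
def nihoCodeTwo (p q : ℕ) (K : Type*) [Field K] [Algebra (ZMod p) K] (γ : Kˣ) {t : ℕ}
    (d : Fin t → ℤ) : Set (Fin (q ^ 2 - 1) → ZMod p) :=
  {c | ∃ a : Fin t → K, ∀ i : Fin (q ^ 2 - 1),
    c i = Algebra.trace (ZMod p) K (∑ j : Fin t, a j * ((γ ^ (d j * (i : ℤ)) : Kˣ) : K))}

/-- `u` is "`n / 2` modulo `q + 1`": for `p = 2` (so `q + 1` is odd) division by `2` takes place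
modulo `q + 1`, for odd `p` it takes place in `ℤ`. -/
def IsHalf (p q : ℕ) (n u : ℤ) : Prop :=
  if p = 2 then 2 * u ≡ n [ZMOD (q : ℤ) + 1] else 2 * u = n

/-- `d_j ≡ s_j (q - 1) + Δ (mod q^2 - 1)` with `s_j ≡ j h + Δ / 2 (mod q + 1)`, `0 ≤ j ≤ t`. -/
def IsExponentsOne (p q h Δ : ℕ) {t : ℕ} (d : Fin (t + 1) → ℤ) : Prop :=
  ∀ j : Fin (t + 1), ∃ s u : ℤ, IsHalf p q (Δ : ℤ) u ∧
    s ≡ (j : ℕ) * (h : ℤ) + u [ZMOD (q : ℤ) + 1] ∧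
    d j ≡ s * ((q : ℤ) - 1) + Δ [ZMOD (q : ℤ) ^ 2 - 1]

/-- `d_j ≡ s_j (q - 1) + Δ (mod q^2 - 1)` with `s_j ≡ j h + (Δ - h) / 2 (mod q + 1)`, `1 ≤ j ≤ t`
(`d_j` is `d (j - 1)` here). -/
def IsExponentsTwo (p q h Δ : ℕ) {t : ℕ} (d : Fin t → ℤ) : Prop :=
  ∀ j : Fin t, ∃ s u : ℤ, IsHalf p q ((Δ : ℤ) - h) u ∧
    s ≡ ((j : ℕ) + 1) * (h : ℤ) + u [ZMOD (q : ℤ) + 1] ∧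
    d j ≡ s * ((q : ℤ) - 1) + Δ [ZMOD (q : ℤ) ^ 2 - 1]

/-- The number of words of Hamming weight `w` in the code `C`. -/
noncomputable def weightFrequency {p n : ℕ} (C : Set (Fin n → ZMod p)) (w : ℚ) : ℕ :=
  {c | c ∈ C ∧ (hammingNorm c : ℚ) = w}.ncard

/-- `B_j = q⁻¹ (q - 1) ^ j + (-1) ^ j (1 - q⁻¹)`. -/
def powerSumB (q j : ℕ) : ℚ :=
  (q : ℚ)⁻¹ * ((q : ℚ) - 1) ^ j + (-1) ^ j * (1 - (q : ℚ)⁻¹)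

open scoped Nat in
/-- `N_0 = 1`, `N_1 = 0`, and for `r ≥ 2`
`N_r = r! e^r ∑ binom((q+1)/e, ∑ λ_j) (∑ λ_j)! ∏ (B_j / j!) ^ λ_j / λ_j!`, summed over all
`λ_2, λ_3, … ≥ 0` with `∑ j λ_j = r`; that condition forces `λ_j = 0` for `j > r` and `λ_j ≤ r`. -/
def powerSumN (q e : ℕ) : ℕ → ℚ
  | 0 => 1
  | 1 => 0
  | r@(_ + 2) =>
    (r ! : ℚ) * (e : ℚ) ^ r *
      ∑ l ∈ (Fintype.piFinset fun _ : Finset.Icc 2 r => Finset.range (r + 1)) with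
          ∑ j : Finset.Icc 2 r, (j : ℕ) * l j = r,
        (Nat.choose ((q + 1) / e) (∑ j, l j) : ℚ) * ((∑ j, l j)! : ℚ) *
          ∏ j : Finset.Icc 2 r, (powerSumB q j / ((j : ℕ)! : ℚ)) ^ l j / ((l j)! : ℚ)

/-- The `n × n` matrix with entries `(j e q - q - 1) ^ i`, `0 ≤ i, j ≤ n - 1`. -/
def momentMatrix (q e n : ℕ) : Matrix (Fin n) (Fin n) ℚ :=
  Matrix.of fun i j => (((j : ℕ) : ℚ) * e * q - q - 1) ^ (i : ℕ)

/-- The vector with entries `q ^ n N_i - (q^2 - 1) ^ i`, `0 ≤ i ≤ n - 1`. -/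
def momentVector (q e n : ℕ) : Fin n → ℚ :=
  fun i => (q : ℚ) ^ n * powerSumN q e i - ((q : ℚ) ^ 2 - 1) ^ (i : ℕ)

/-- The number of `(x_1, …, x_r) ∈ (K^*)^r` with `x_1 ^ d_j + ⋯ + x_r ^ d_j = 0` for all `j`. -/
noncomputable def powerSumCount (K : Type*) [Field K] {n : ℕ} (d : Fin n → ℤ) (r : ℕ) : ℕ :=
  {x : Fin r → Kˣ | ∀ j, ∑ k, ((x k ^ d j : Kˣ) : K) = 0}.ncard

/-!
Since the trace from `K` to `L` is `z ↦ z + z ^ q`, the `L`-valued function underlying the word with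
coefficient vector `a` is `x ↦ x ^ D * P_a (x ^ ((q - 1) h))` on `Kˣ`, where `P_a` is, for `a ≠ 0`,
a nonzero polynomial of degree less than the `L`-dimension `n` of the space of all `a`. It therefore
vanishes at fewer than `n` of the `(q + 1) / e` nodes `x ^ ((q - 1) h)`: the functionals `a ↦ P_a`
at the nodes form an MDS family, so that any `n` of them are independent.

Scalars from `Lˣ` permute the points `x`. Hence, if `a` vanishes at `z` nodes, the word has weight
`(p - 1) / p * (q ^ 2 - (e z - 1) q)`, and a nontrivial additive character of `L` sums to
`e q z - (q + 1)` over the values of the function. By orthogonality of characters the `r`-th moment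
of this quantity counts the solutions of the system of power sums; by independence and the
exponential formula it is `N_r` for `r ≤ n`. Since `z < n` for `a ≠ 0`, the moments of order less
than `n` determine the frequencies of the values of `z` through a Vandermonde system.
-/

open Finset Polynomial
open scoped BigOperators

section ExponentialFormula

open scoped Nat

variable {R : Type*}

theorem coeff_sum_C_mul_X_pow_pow [CommSemiring R] {ι : Type*} [Fintype ι] [DecidableEq ι]
    (c : ι → R) (d : ι → ℕ) (k r : ℕ) :
    ((∑ i, C (c i) * X ^ d i) ^ k).coeff r =
      ∑ l ∈ piAntidiag univ k with ∑ i, d i * l i = r,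
        (Nat.multinomial univ l : R) * ∏ i, c i ^ l i := by
  rw [sum_pow_eq_sum_piAntidiag, finsetSum_coeff, sum_filter]
  refine sum_congr rfl fun l _ => ?_
  have hprod : ∏ i, (C (c i) * X ^ d i) ^ l i = C (∏ i, c i ^ l i) * X ^ ∑ i, d i * l i := by
    simp only [mul_pow, prod_mul_distrib, ← pow_mul, prod_pow_eq_pow_sum, map_prod, map_pow]
  rw [hprod, ← C_eq_natCast, coeff_C_mul, coeff_C_mul, coeff_X_pow]
  simp only [eq_comm (a := r), mul_ite, mul_one, mul_zero]

section Field

variable [Field R] [CharZero R]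

theorem cast_multinomial_eq_div {ι : Type*} (s : Finset ι) (l : ι → ℕ) :
    (Nat.multinomial s l : R) = ((∑ i ∈ s, l i)! : R) / ∏ i ∈ s, ((l i)! : R) := by
  rw [eq_div_iff (prod_ne_zero_iff.2 fun i _ => Nat.cast_ne_zero.2 (l i).factorial_ne_zero),
    mul_comm, ← Nat.multinomial_spec]
  push_cast
  rfl

theorem coeff_one_add_sum_C_mul_X_pow_pow {ι : Type*} [Fintype ι] [DecidableEq ι] (c : ι → R)
    {d : ι → ℕ} (hd : ∀ i, d i ≠ 0) (N r : ℕ) :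
    ((1 + ∑ i, C (c i) * X ^ d i) ^ N).coeff r =
      ∑ l ∈ (Fintype.piFinset fun _ : ι => range (r + 1)) with ∑ i, d i * l i = r,
        (N.choose (∑ i, l i) : R) * ((∑ i, l i)! : R) * ∏ i, c i ^ l i / ((l i)! : R) := by
  have hbound (l : ι → ℕ) (hl : ∑ i, d i * l i = r) (i : ι) : l i < r + 1 :=
    Nat.lt_succ_of_le <| (Nat.le_mul_of_pos_left _ (Nat.pos_of_ne_zero (hd i))).trans <|
      (single_le_sum (f := fun i => d i * l i) (fun _ _ => Nat.zero_le _) (mem_univ i)).trans hl.le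
  have hterm (k : ℕ) : ((∑ i, C (c i) * X ^ d i) ^ k * 1 ^ (N - k) * (N.choose k : R[X])).coeff r =
      ∑ l ∈ ({l ∈ Fintype.piFinset fun _ : ι => range (r + 1) | ∑ i, d i * l i = r} :
          Finset (ι → ℕ)) with ∑ i, l i = k,
        (N.choose (∑ i, l i) : R) * ((∑ i, l i)! : R) * ∏ i, c i ^ l i / ((l i)! : R) := by
    rw [one_pow, mul_one, ← C_eq_natCast, coeff_mul_C, coeff_sum_C_mul_X_pow_pow, sum_mul]
    refine sum_congr ?_ fun l hl => ?_
    · ext l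
      simp only [mem_filter, mem_piAntidiag, mem_univ, implies_true, and_true, Fintype.mem_piFinset,
        mem_range]
      exact ⟨fun h => ⟨⟨hbound l h.2, h.2⟩, h.1⟩, fun h => ⟨h.2, h.1.2⟩⟩
    · rw [(mem_filter.1 hl).2, cast_multinomial_eq_div, (mem_filter.1 hl).2, prod_div_distrib]
      ring
  rw [add_comm, add_pow, finsetSum_coeff]
  simp only [hterm]
  rw [sum_fiberwise_eq_sum_filter]
  refine sum_filter_of_ne fun l _ hl => mem_range.2 (Nat.lt_succ_of_le ?_)
  by_contra! hlt
  exact hl (by rw [Nat.choose_eq_zero_of_lt hlt, Nat.cast_zero, zero_mul, zero_mul])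

theorem sum_multinomial_mul_prod {W : Type*} [Fintype W] [DecidableEq W] (B : ℕ → R) (r : ℕ) :
    ∑ k ∈ piAntidiag univ r, (Nat.multinomial univ k : R) * ∏ w : W, B (k w) =
      (r ! : R) *
        ((∑ j ∈ range (r + 1), C (B j / (j ! : R)) * X ^ j) ^ Fintype.card W).coeff r := by
  rw [← card_univ, ← prod_const, prod_univ_sum, finsetSum_coeff, mul_sum]
  simp only [prod_mul_distrib, prod_pow_eq_pow_sum, ← map_prod, coeff_C_mul, coeff_X_pow, mul_ite,
    mul_one, mul_zero]
  rw [← sum_filter]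
  refine sum_congr ?_ fun k hk => ?_
  · ext k
    simp only [mem_piAntidiag, mem_univ, implies_true, and_true, mem_filter, Fintype.mem_piFinset,
      mem_range]
    refine ⟨fun hk => ⟨fun w => Nat.lt_succ_of_le ?_, hk.symm⟩, fun hk => hk.2.symm⟩
    exact (single_le_sum (f := k) (fun _ _ => Nat.zero_le _) (mem_univ w)).trans hk.le
  · rw [cast_multinomial_eq_div, ← (mem_filter.1 hk).2, prod_div_distrib]
    ring

end Field

theorem powerSumB_zero (q : ℕ) : powerSumB q 0 = 1 := by
  simp [powerSumB]

theorem powerSumB_one {q : ℕ} (hq : q ≠ 0) : powerSumB q 1 = 0 := by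
  rw [powerSumB]
  field_simp
  ring

theorem powerSumN_eq_sum_multinomial {W : Type*} [Fintype W] [DecidableEq W] {q e : ℕ} (hq : q ≠ 0)
    (hW : Fintype.card W = (q + 1) / e) (r : ℕ) :
    powerSumN q e r = (e : ℚ) ^ r *
      ∑ k ∈ piAntidiag univ r, (Nat.multinomial univ k : ℚ) * ∏ w : W, powerSumB q (k w) := by
  rw [sum_multinomial_mul_prod]
  match r with
  | 0 => simp [powerSumN, powerSumB_zero]
  | 1 =>
    simp [powerSumN, sum_range_succ, powerSumB_zero, powerSumB_one hq, coeff_one]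
  | r + 2 =>
    have hgf : ∑ j ∈ range (r + 2 + 1), C (powerSumB q j / (j ! : ℚ)) * X ^ j =
        1 + ∑ j : Icc 2 (r + 2), C (powerSumB q j / ((j : ℕ)! : ℚ)) * X ^ (j : ℕ) := by
      rw [sum_coe_sort (Icc 2 (r + 2)) fun j : ℕ => C (powerSumB q j / (j ! : ℚ)) * X ^ j,
        show Icc 2 (r + 2) = Ico 2 (r + 2 + 1) from rfl, range_eq_Ico,
        sum_eq_sum_Ico_succ_bot (by omega), sum_eq_sum_Ico_succ_bot (by omega)]
      simp [powerSumB_zero, powerSumB_one hq]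
    have hpos (j : Icc 2 (r + 2)) : (j : ℕ) ≠ 0 := by
      have := (mem_Icc.1 j.2).1
      omega
    rw [hgf, hW, coeff_one_add_sum_C_mul_X_pow_pow _ hpos, ← mul_assoc,
      mul_comm ((e : ℚ) ^ (r + 2)), powerSumN]

end ExponentialFormula

section MDSFamily

theorem expect_comp_of_surjective {A B M : Type*} [AddGroup A] [AddGroup B] [Fintype A] [Fintype B]
    [AddCommMonoid M] [Module ℚ≥0 M] (φ : A →+ B) (hφ : Function.Surjective φ) (F : B → M) :
    𝔼 a, F (φ a) = 𝔼 b, F b := by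
  have hshift (b : B) : 𝔼 a, F (φ a) = 𝔼 a, F (φ a + b) := by
    obtain ⟨c, rfl⟩ := hφ b
    exact (Fintype.expect_equiv (Equiv.addRight c) _ _ fun a => by simp).symm
  calc 𝔼 a, F (φ a) = 𝔼 _b : B, 𝔼 a, F (φ a) := (Fintype.expect_const _).symm
    _ = 𝔼 b, 𝔼 a, F (φ a + b) := expect_congr rfl fun b _ => hshift b
    _ = 𝔼 a, 𝔼 b, F (φ a + b) := expect_comm _ _ _
    _ = 𝔼 _a : A, 𝔼 b, F b :=
      expect_congr rfl fun a _ => Fintype.expect_equiv (Equiv.addLeft (φ a)) _ _ fun _ => rfl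
    _ = 𝔼 b, F b := Fintype.expect_const _

theorem expect_pi_prod {ι κ R : Type*} [Fintype ι] [DecidableEq ι] [Fintype κ] [Field R]
    [CharZero R] (F : ι → κ → R) :
    𝔼 y : ι → κ, ∏ i, F i (y i) = ∏ i, 𝔼 y, F i y := by
  simp only [Fintype.expect_eq_sum_div_card, prod_div_distrib, prod_univ_sum, Fintype.piFinset_univ,
    prod_const, Fintype.card_fun, card_univ, Nat.cast_pow]

variable {W L A : Type*} [Fintype W] [Field L] [DecidableEq L] [AddCommGroup A] [Module L A]

/-- The number of functionals of the family `g` that vanish at `a`. -/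
def zeroCount (g : W → Module.Dual L A) (a : A) : ℕ :=
  #{w | g w a = 0}

/-- The evaluation code `{(g w a)_w | a ∈ A}` is MDS: a nonzero `a` is annihilated by fewer than
`dim A` of the functionals `g w`. -/
def IsMDSFamily (g : W → Module.Dual L A) : Prop :=
  ∀ a ≠ 0, zeroCount g a < Module.finrank L A

theorem zeroCount_zero (g : W → Module.Dual L A) : zeroCount g 0 = Fintype.card W := by
  simp [zeroCount]

theorem sum_ite_eq_zeroCount (g : W → Module.Dual L A) (a : A) {R : Type*} [CommRing R] (q : R) :
    ∑ w, (if g w a = 0 then q - 1 else -1) = q * zeroCount g a - Fintype.card W := by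
  have hsplit (w : W) : (if g w a = 0 then q - 1 else -1) = (if g w a = 0 then q else 0) - 1 := by
    split_ifs <;> ring
  simp only [hsplit, sum_sub_distrib, sum_const, card_univ, nsmul_eq_mul, mul_one, zeroCount,
    ← sum_filter]
  ring

theorem IsMDSFamily.pi_surjective [FiniteDimensional L A] {g : W → Module.Dual L A}
    (hg : IsMDSFamily g) (hW : Module.finrank L A ≤ Fintype.card W) {S : Finset W}
    (hS : #S ≤ Module.finrank L A) :
    Function.Surjective (LinearMap.pi fun w : S => g w) := by
  classical
  obtain ⟨T, hST, -, hT⟩ :=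
    exists_subsuperset_card_eq (subset_univ S) hS (hW.trans_eq card_univ.symm)
  have hinj : Function.Injective (LinearMap.pi fun w : T => g w) := by
    refine (injective_iff_map_eq_zero _).2 fun a ha => ?_
    by_contra hne
    refine (hg a hne).not_ge (hT.symm.trans_le (card_le_card fun w hw => ?_))
    exact mem_filter.2 ⟨mem_univ w, congrFun ha ⟨w, hw⟩⟩
  have hsurj := (LinearMap.injective_iff_surjective_of_finrank_eq_finrank (by simp [hT])).1 hinj
  intro y
  obtain ⟨a, ha⟩ := hsurj fun w => if hw : (w : W) ∈ S then y ⟨w, hw⟩ else 0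
  exact ⟨a, funext fun w => by simpa using congrFun ha ⟨w, hST w.2⟩⟩

theorem IsMDSFamily.expect_prod [Fintype L] [Fintype A] {g : W → Module.Dual L A}
    (hg : IsMDSFamily g) (hW : Module.finrank L A ≤ Fintype.card W) {S : Finset W}
    (hS : #S ≤ Module.finrank L A) {R : Type*} [Field R] [CharZero R] (F : W → L → R) :
    𝔼 a, ∏ w ∈ S, F w (g w a) = ∏ w ∈ S, 𝔼 y, F w y := by
  classical
  have := expect_comp_of_surjective (LinearMap.pi fun w : S => g w).toAddMonoidHom
    (hg.pi_surjective hW hS) fun y => ∏ w : S, F w (y w)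
  rw [expect_pi_prod fun (w : S) y => F w y, prod_coe_sort S fun w => 𝔼 y, F w y] at this
  rw [← this]
  exact expect_congr rfl fun a _ => (prod_coe_sort S fun w => F w (g w a)).symm

theorem IsMDSFamily.expect_prod_pow [Fintype L] [Fintype A] {g : W → Module.Dual L A}
    (hg : IsMDSFamily g) (hW : Module.finrank L A ≤ Fintype.card W) {R : Type*} [Field R]
    [CharZero R] (Y : L → R) {k : W → ℕ} (hk : ∑ w, k w ≤ Module.finrank L A) :
    𝔼 a, ∏ w, Y (g w a) ^ k w = ∏ w, 𝔼 y, Y y ^ k w := by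
  have hS : #{w | k w ≠ 0} ≤ Module.finrank L A := by
    refine le_trans ?_ hk
    rw [card_filter]
    exact sum_le_sum fun w _ => by split_ifs <;> omega
  rw [← prod_filter_of_ne (p := fun w => k w ≠ 0) (f := fun w => 𝔼 y, Y y ^ k w),
    ← hg.expect_prod hW hS fun w y => Y y ^ k w]
  · refine expect_congr rfl fun a _ => (prod_filter_of_ne fun w _ => ?_).symm
    exact mt fun hkw => by rw [hkw, pow_zero]
  · exact fun w _ => mt fun hkw => by simp only [hkw, pow_zero, Fintype.expect_const]

theorem expect_ite_pow_eq_powerSumB (L : Type*) [Field L] [DecidableEq L] [Fintype L] (j : ℕ) :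
    𝔼 y : L, (if y = 0 then (Fintype.card L : ℚ) - 1 else -1) ^ j =
      powerSumB (Fintype.card L) j := by
  have hq : (Fintype.card L : ℚ) ≠ 0 := Nat.cast_ne_zero.2 Fintype.card_ne_zero
  have hne : ∀ y ∈ univ.erase (0 : L),
      (if y = 0 then (Fintype.card L : ℚ) - 1 else -1) ^ j = (-1) ^ j := fun y hy => by
    rw [if_neg (ne_of_mem_erase hy)]
  rw [Fintype.expect_eq_sum_div_card, ← add_sum_erase _ _ (mem_univ (0 : L)), sum_congr rfl hne,
    sum_const, card_erase_of_mem (mem_univ _), card_univ, nsmul_eq_mul,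
    Nat.cast_pred Fintype.card_pos, if_pos rfl, powerSumB]
  field_simp

theorem IsMDSFamily.expect_zeroCount_pow [Fintype L] [Fintype A] {g : W → Module.Dual L A}
    (hg : IsMDSFamily g) (hW : Module.finrank L A ≤ Fintype.card W) {e r : ℕ}
    (he : Fintype.card W * e = Fintype.card L + 1) (hr : r ≤ Module.finrank L A) :
    𝔼 a, ((zeroCount g a : ℚ) * e * Fintype.card L - Fintype.card L - 1) ^ r =
      powerSumN (Fintype.card L) e r := by
  classical
  have he0 : 0 < e := Nat.pos_of_ne_zero (by rintro rfl; simp at he)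
  have hcard : Fintype.card W = (Fintype.card L + 1) / e := by
    rw [← he, Nat.mul_div_cancel _ he0]
  have hsum (a : A) : (zeroCount g a : ℚ) * e * Fintype.card L - Fintype.card L - 1 =
      e * ∑ w, if g w a = 0 then (Fintype.card L : ℚ) - 1 else -1 := by
    have he' : (Fintype.card W * e : ℚ) = Fintype.card L + 1 := by exact_mod_cast he
    rw [sum_ite_eq_zeroCount]
    linear_combination he'
  simp only [hsum, mul_pow, ← mul_expect, sum_pow_eq_sum_piAntidiag, expect_sum_comm]
  rw [powerSumN_eq_sum_multinomial Fintype.card_ne_zero hcard]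
  congr 1
  refine sum_congr rfl fun k hk => ?_
  rw [hg.expect_prod_pow hW (fun y => if y = 0 then (Fintype.card L : ℚ) - 1 else -1)
    ((mem_piAntidiag.1 hk).1.trans_le hr)]
  simp only [expect_ite_pow_eq_powerSumB]

end MDSFamily

section Repetition

variable {L A X W : Type*} [Field L] [AddCommGroup A] [Module L A]

/-- The family `f` of functionals consists of the multiples of the members of the family `g`: the
functionals `f x` and `g (v x)` have the same kernel, every nonzero scalar acts on `f` by a
permutation of the indices, and every index `w` of `g` is hit `e (q - 1)` times, `q = #L`. -/
structure IsRepetition [Fintype L] [Fintype X] [DecidableEq W] (e : ℕ) (v : X → W)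
    (f : X → Module.Dual L A) (g : W → Module.Dual L A) : Prop where
  exists_perm_smul (l : Lˣ) : ∃ σ : Equiv.Perm X, ∀ x, f (σ x) = (l : L) • f x
  apply_eq_zero_iff (x : X) (a : A) : f x a = 0 ↔ g (v x) a = 0
  card_fiber (w : W) : #{x | v x = w} = e * (Fintype.card L - 1)

theorem sum_units_eq_sum_sub {R : Type*} [AddCommGroup R] [DecidableEq L] [Fintype L] (F : L → R) :
    ∑ l : Lˣ, F l = ∑ y, F y - F 0 := by
  rw [← sum_erase_eq_sub (mem_univ 0)]
  refine sum_bij (fun l _ => (l : L)) (fun l _ => by simp) (fun _ _ _ _ h => Units.ext h)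
    (fun b hb => ⟨Units.mk0 b (ne_of_mem_erase hb), mem_univ _, rfl⟩) (fun _ _ => rfl)

theorem sum_units_mul_eq_ite {R : Type*} [CommRing R] [DecidableEq L] [Fintype L] (F : L → R)
    (y : L) : ∑ l : Lˣ, F (l * y) =
      if y = 0 then ((Fintype.card L : R) - 1) * F 0 else ∑ z, F z - F 0 := by
  split_ifs with hy
  · simp only [hy, mul_zero, sum_const, card_univ, Fintype.card_units, nsmul_eq_mul,
      Nat.cast_pred Fintype.card_pos]
  · rw [← sum_units_eq_sum_sub]
    exact Equiv.sum_comp (Equiv.mulRight (Units.mk0 y hy)) fun l : Lˣ => F l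

namespace IsRepetition

variable [Fintype L] [Fintype X] [Fintype W] [DecidableEq W] {e : ℕ} {v : X → W}
  {f : X → Module.Dual L A} {g : W → Module.Dual L A}

theorem card_eq (H : IsRepetition e v f g) :
    Fintype.card X = Fintype.card W * (e * (Fintype.card L - 1)) := by
  rw [← card_univ, card_eq_sum_card_fiberwise (f := v) (t := univ) fun _ _ => mem_univ _,
    sum_const_nat fun w _ => H.card_fiber w, card_univ]

variable [DecidableEq L]

theorem card_apply_eq_zero (H : IsRepetition e v f g) (a : A) :
    #{x | f x a = 0} = zeroCount g a * (e * (Fintype.card L - 1)) := by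
  simp only [H.apply_eq_zero_iff]
  rw [zeroCount, ← sum_const_nat fun w _ => H.card_fiber w, card_eq_sum_card_fiberwise
    (f := v) (t := {w | g w a = 0}) fun x hx => by simpa using hx]
  refine sum_congr rfl fun w hw => congrArg card ?_
  ext x
  simp only [mem_filter, mem_univ, true_and, and_iff_right_iff_imp]
  rintro rfl
  exact (mem_filter.1 hw).2

theorem sum_apply (H : IsRepetition e v f g) {R : Type*} [Field R] [CharZero R] (F : L → R)
    (a : A) : ∑ x, F (f x a) = e * (zeroCount g a * ((Fintype.card L - 1) * F 0) +
      (Fintype.card W - zeroCount g a) * (∑ y, F y - F 0)) := by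
  have hq : (Fintype.card L : R) - 1 ≠ 0 :=
    sub_ne_zero.2 (by exact_mod_cast Fintype.one_lt_card.ne')
  have hscale (l : Lˣ) : ∑ x, F (l * f x a) = ∑ x, F (f x a) := by
    obtain ⟨σ, hσ⟩ := H.exists_perm_smul l
    simpa only [hσ, LinearMap.smul_apply, smul_eq_mul] using Equiv.sum_comp σ fun x => F (f x a)
  have hzero := congrArg (Nat.cast (R := R)) (H.card_apply_eq_zero a)
  have hnonzero := congrArg (Nat.cast (R := R))
    ((card_filter_add_card_filter_not (s := univ) fun x => f x a = 0).trans H.card_eq)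
  push_cast [Nat.cast_pred Fintype.card_pos] at hzero hnonzero
  refine mul_left_cancel₀ hq ?_
  calc ((Fintype.card L : R) - 1) * ∑ x, F (f x a)
      = ∑ l : Lˣ, ∑ x, F (l * f x a) := by
        simp only [hscale, sum_const, card_univ, Fintype.card_units, nsmul_eq_mul,
          Nat.cast_pred Fintype.card_pos]
    _ = ∑ x, if f x a = 0 then ((Fintype.card L : R) - 1) * F 0 else ∑ z, F z - F 0 := by
        rw [sum_comm]
        exact sum_congr rfl fun x _ => sum_units_mul_eq_ite F _
    _ = #{x | f x a = 0} * ((Fintype.card L - 1) * F 0) +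
          #{x | ¬ f x a = 0} * (∑ z, F z - F 0) := by
        simp only [sum_ite, sum_const, nsmul_eq_mul]
    _ = _ := by
        linear_combination (((Fintype.card L : R) - 1) * F 0 - (∑ z, F z - F 0)) * hzero +
          (∑ z, F z - F 0) * hnonzero

theorem sum_addChar_apply (H : IsRepetition e v f g)
    (he : Fintype.card W * e = Fintype.card L + 1) {ψ : AddChar L ℂ} (hψ : ψ ≠ 0) (a : A) :
    ∑ x, ψ (f x a) = zeroCount g a * e * Fintype.card L - Fintype.card L - 1 := by
  have he' : (Fintype.card W * e : ℂ) = Fintype.card L + 1 := by exact_mod_cast he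
  rw [H.sum_apply ψ a, AddChar.sum_eq_zero_iff_ne_zero.2 hψ, AddChar.map_zero_eq_one]
  linear_combination -he'

end IsRepetition

theorem addChar_map_sum {ι B M : Type*} [AddCommMonoid B] [CommMonoid M] (ψ : AddChar B M)
    (s : Finset ι) (u : ι → B) : ψ (∑ i ∈ s, u i) = ∏ i ∈ s, ψ (u i) :=
  map_prod ψ.toMonoidHom (fun i => Multiplicative.ofAdd (u i)) s

theorem expect_addChar_dual [Finite L] [Fintype A] {ψ : AddChar L ℂ} (hψ : ψ ≠ 0)
    (φ : Module.Dual L A) [Decidable (φ = 0)] : 𝔼 a, ψ (φ a) = if φ = 0 then 1 else 0 := by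
  have := Fintype.ofFinite L
  split_ifs with hφ
  · simp only [hφ, LinearMap.zero_apply, AddChar.map_zero_eq_one, Fintype.expect_one]
  · exact (expect_comp_of_surjective φ.toAddMonoidHom (LinearMap.surjective hφ) ψ).trans
      (AddChar.expect_eq_zero_iff_ne_zero.2 hψ)

theorem expect_sum_addChar_pow [Finite L] [Fintype A] [Fintype X] {ψ : AddChar L ℂ} (hψ : ψ ≠ 0)
    (f : X → Module.Dual L A) (r : ℕ) [DecidablePred fun x : Fin r → X => ∑ k, f (x k) = 0] :
    𝔼 a, (∑ x, ψ (f x a)) ^ r = #{x : Fin r → X | ∑ k, f (x k) = 0} := by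
  simp only [Fintype.sum_pow, ← addChar_map_sum, ← LinearMap.sum_apply]
  rw [expect_sum_comm]
  simp only [expect_addChar_dual hψ, sum_boole]

theorem IsRepetition.card_sum_eq_zero [Fintype L] [DecidableEq L] [Finite A]
    [Fintype X] [Fintype W] [DecidableEq W] {e r : ℕ} {v : X → W} {f : X → Module.Dual L A}
    {g : W → Module.Dual L A} (H : IsRepetition e v f g) (hg : IsMDSFamily g)
    (hW : Module.finrank L A ≤ Fintype.card W) (he : Fintype.card W * e = Fintype.card L + 1)
    (hr : r ≤ Module.finrank L A) [DecidablePred fun x : Fin r → X => ∑ k, f (x k) = 0] :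
    (#{x : Fin r → X | ∑ k, f (x k) = 0} : ℚ) = powerSumN (Fintype.card L) e r := by
  have := Fintype.ofFinite A
  obtain ⟨ψ, hψ⟩ := AddChar.exists_apply_ne_zero.2 (one_ne_zero (α := L))
  have hψ0 : ψ ≠ 0 := AddChar.ne_zero_iff.2 ⟨1, hψ⟩
  have hmoment := expect_sum_addChar_pow hψ0 f r
  simp only [H.sum_addChar_apply he hψ0] at hmoment
  rw [← hg.expect_zeroCount_pow hW he hr]
  rw [Fintype.expect_eq_sum_div_card] at hmoment ⊢
  exact_mod_cast hmoment.symm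

theorem card_apply_ne_zero_of_surjective {p : ℕ} [Fact p.Prime] {G : Type*} [AddGroup G]
    [Fintype G] (τ : G →+ ZMod p) (hτ : Function.Surjective τ) :
    (#{x | τ x ≠ 0} : ℚ) = ((p : ℚ) - 1) / p * Fintype.card G := by
  have hp : (p : ℚ) ≠ 0 := Nat.cast_ne_zero.2 (Fact.out : p.Prime).ne_zero
  have hfib (y : ZMod p) : #{x | τ x = y} = #{x | τ x = 0} :=
    AddMonoidHom.card_fiber_eq_of_mem_range τ (hτ y) (hτ 0)
  have hcard := card_eq_sum_card_fiberwise (f := τ) (s := univ) (t := univ) fun _ _ => mem_univ _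
  simp only [hfib, sum_const, card_univ, ZMod.card, smul_eq_mul] at hcard
  have hne : (#{x | τ x ≠ 0} : ℚ) = Fintype.card G - #{x | τ x = 0} := by
    rw [eq_sub_iff_add_eq', ← card_univ]
    exact_mod_cast card_filter_add_card_filter_not (s := univ) fun x => τ x = 0
  rw [hne, hcard]
  push_cast
  field_simp

theorem IsRepetition.card_apply_ne_zero [Fintype L] [DecidableEq L] [Fintype X] [Fintype W]
    [DecidableEq W] {e p : ℕ} [Fact p.Prime] {v : X → W} {f : X → Module.Dual L A}
    {g : W → Module.Dual L A} (H : IsRepetition e v f g)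
    (he : Fintype.card W * e = Fintype.card L + 1) (τ : L →+ ZMod p) (hτ : Function.Surjective τ)
    (a : A) : (#{x | τ (f x a) ≠ 0} : ℚ) = ((p : ℚ) - 1) / p *
      ((Fintype.card L : ℚ) ^ 2 - (zeroCount g a * e - 1) * Fintype.card L) := by
  have he' : (Fintype.card W * e : ℚ) = Fintype.card L + 1 := by exact_mod_cast he
  have hsum := H.sum_apply (fun y => if τ y ≠ 0 then (1 : ℚ) else 0) a
  rw [sum_boole, sum_boole, card_apply_ne_zero_of_surjective τ hτ, map_zero,
    if_neg (not_not_intro rfl)] at hsum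
  rw [hsum]
  linear_combination ((p : ℚ) - 1) / p * Fintype.card L * he'

end Repetition

section MomentSystem

theorem momentMatrix_eq_transpose_vandermonde (q e n : ℕ) : momentMatrix q e n =
    (Matrix.vandermonde fun j : Fin n => ((j : ℕ) : ℚ) * e * q - q - 1).transpose := by
  ext i j
  rw [momentMatrix, Matrix.of_apply, Matrix.transpose_apply, Matrix.vandermonde_apply]

theorem isUnit_det_momentMatrix {q e : ℕ} (hq : q ≠ 0) (he : e ≠ 0) (n : ℕ) :
    IsUnit (momentMatrix q e n).det := by
  rw [momentMatrix_eq_transpose_vandermonde, Matrix.det_transpose, isUnit_iff_ne_zero,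
    Matrix.det_vandermonde_ne_zero_iff]
  intro i j hij
  have hij' : ((i : ℕ) : ℚ) = (j : ℕ) := by
    refine mul_right_cancel₀ (Nat.cast_ne_zero.2 he) (mul_right_cancel₀ (Nat.cast_ne_zero.2 hq) ?_)
    simpa only [sub_left_inj] using hij
  exact Fin.ext (by exact_mod_cast hij')

variable {W L A : Type*} [Fintype W] [Field L] [DecidableEq L] [AddCommGroup A] [Fintype A]
  [Module L A] {g : W → Module.Dual L A}

theorem IsMDSFamily.sum_comp_zeroCount (hg : IsMDSFamily g)
    (hW : Module.finrank L A ≤ Fintype.card W) {R : Type*} [CommRing R] (F : ℕ → R) :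
    ∑ a, F (zeroCount g a) = F (Fintype.card W) +
      ∑ j : Fin (Module.finrank L A), F j * #{a | zeroCount g a = j} := by
  classical
  rw [← add_sum_erase _ _ (mem_univ 0), zeroCount_zero,
    ← sum_fiberwise_of_maps_to (g := zeroCount g) (t := range (Module.finrank L A))
      fun a ha => mem_range.2 (hg a (ne_of_mem_erase ha)), sum_range]
  congr 1
  refine sum_congr rfl fun j _ => ?_
  have hne (a : A) (ha : zeroCount g a = j) : a ≠ 0 := by
    rintro rfl
    exact j.2.not_ge (hW.trans_eq ((zeroCount_zero g).symm.trans ha))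
  have hfilter :
      (univ.erase (0 : A)).filter (zeroCount g · = j) = univ.filter (zeroCount g · = j) :=
    ext fun a => by simpa using hne a
  rw [hfilter, sum_congr rfl fun a ha => congrArg F (mem_filter.1 ha).2, sum_const, nsmul_eq_mul,
    mul_comm]

theorem IsMDSFamily.momentMatrix_mulVec [Fintype L] (hg : IsMDSFamily g)
    (hW : Module.finrank L A ≤ Fintype.card W) {e : ℕ}
    (he : Fintype.card W * e = Fintype.card L + 1) :
    (momentMatrix (Fintype.card L) e (Module.finrank L A)).mulVec
      (fun j => (#{a | zeroCount g a = (j : ℕ)} : ℚ)) =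
        momentVector (Fintype.card L) e (Module.finrank L A) := by
  have he' : (Fintype.card W * e : ℚ) = Fintype.card L + 1 := by exact_mod_cast he
  ext i
  have hmoment := hg.expect_zeroCount_pow hW he i.2.le
  rw [Fintype.expect_eq_sum_div_card,
    hg.sum_comp_zeroCount hW fun z => ((z : ℚ) * e * Fintype.card L - Fintype.card L - 1) ^ (i : ℕ),
    Module.card_eq_pow_finrank (K := L) (V := A), div_eq_iff (by positivity), he'] at hmoment
  rw [momentVector, ← mul_comm (powerSumN _ _ _), ← Nat.cast_pow, ← hmoment]
  simp only [Matrix.mulVec, dotProduct, momentMatrix, Matrix.of_apply]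
  ring

end MomentSystem

namespace IsRepetition

variable {W L A X : Type*} [Fintype W] [Field L] [Fintype L] [DecidableEq L] [AddCommGroup A]
  [Module L A] [Fintype X] [DecidableEq W] {e p M : ℕ} [Fact p.Prime] {v : X → W}
  {f : X → Module.Dual L A} {g : W → Module.Dual L A}

theorem hammingNorm_eq (H : IsRepetition e v f g) (he : Fintype.card W * e = Fintype.card L + 1)
    (τ : L →+ ZMod p) (hτ : Function.Surjective τ) (ξ : Fin M ≃ X) (a : A) :
    (hammingNorm fun i => τ (f (ξ i) a) : ℚ) = ((p : ℚ) - 1) / p *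
      ((Fintype.card L : ℚ) ^ 2 - (zeroCount g a * e - 1) * Fintype.card L) := by
  rw [← H.card_apply_ne_zero he τ hτ]
  exact congrArg Nat.cast (card_equiv ξ fun i => by simp)

theorem hammingNorm_eq_iff (H : IsRepetition e v f g)
    (he : Fintype.card W * e = Fintype.card L + 1) (τ : L →+ ZMod p) (hτ : Function.Surjective τ)
    (ξ : Fin M ≃ X) (a : A) (j : ℕ) :
    (hammingNorm fun i => τ (f (ξ i) a) : ℚ) = ((p : ℚ) - 1) / p *
      ((Fintype.card L : ℚ) ^ 2 - (j * e - 1) * Fintype.card L) ↔ zeroCount g a = j := by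
  have hp : ((p : ℚ) - 1) / p ≠ 0 :=
    div_ne_zero (sub_ne_zero.2 (by exact_mod_cast (Fact.out : p.Prime).ne_one))
      (Nat.cast_ne_zero.2 (Fact.out : p.Prime).ne_zero)
  have hq : (Fintype.card L : ℚ) ≠ 0 := Nat.cast_ne_zero.2 Fintype.card_ne_zero
  have he0 : (e : ℚ) ≠ 0 := Nat.cast_ne_zero.2 (by rintro rfl; simp at he)
  rw [H.hammingNorm_eq he τ hτ, mul_right_inj' hp, sub_right_inj, mul_left_inj' hq, sub_left_inj,
    mul_left_inj' he0, Nat.cast_inj]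

theorem word_injective (H : IsRepetition e v f g) (hg : IsMDSFamily g)
    (hW : Module.finrank L A ≤ Fintype.card W) (he : Fintype.card W * e = Fintype.card L + 1)
    (τ : L →+ ZMod p) (hτ : Function.Surjective τ) (ξ : Fin M ≃ X) :
    Function.Injective fun (a : A) i => τ (f (ξ i) a) := by
  intro a b hab
  have hzero : (fun i => τ (f (ξ i) (a - b))) = fun i => τ (f (ξ i) 0) := funext fun i => by
    rw [map_sub, map_sub, sub_eq_zero.2 (congrFun hab i), map_zero, map_zero]
  have hcount : zeroCount g (a - b) = Fintype.card W := by
    rw [← H.hammingNorm_eq_iff he τ hτ ξ, hzero, H.hammingNorm_eq_iff he τ hτ ξ, zeroCount_zero]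
  by_contra hne
  exact (hg _ (sub_ne_zero.2 hne)).not_ge (hcount ▸ hW)

theorem weightFrequency_eq [Fintype A] (H : IsRepetition e v f g) (hg : IsMDSFamily g)
    (hW : Module.finrank L A ≤ Fintype.card W) (he : Fintype.card W * e = Fintype.card L + 1)
    (τ : L →+ ZMod p) (hτ : Function.Surjective τ) (ξ : Fin M ≃ X) (j : ℕ) :
    weightFrequency (Set.range fun (a : A) i => τ (f (ξ i) a)) (((p : ℚ) - 1) / p *
      ((Fintype.card L : ℚ) ^ 2 - (j * e - 1) * Fintype.card L)) = #{a | zeroCount g a = j} := by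
  rw [weightFrequency, ← Set.ncard_coe_finset,
    ← Set.ncard_image_of_injective _ (H.word_injective hg hW he τ hτ ξ)]
  congr 1
  ext u
  simp only [Set.mem_ofPred_eq, Set.mem_range, Set.mem_image, coe_filter, mem_univ, true_and]
  refine ⟨?_, ?_⟩
  · rintro ⟨⟨a, rfl⟩, hu⟩
    exact ⟨a, (H.hammingNorm_eq_iff he τ hτ ξ a j).1 hu, rfl⟩
  · rintro ⟨a, ha, rfl⟩
    exact ⟨⟨a, rfl⟩, (H.hammingNorm_eq_iff he τ hτ ξ a j).2 ha⟩

theorem weightFrequency_eq_inv_mulVec [Finite A] (H : IsRepetition e v f g) (hg : IsMDSFamily g)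
    (hW : Module.finrank L A ≤ Fintype.card W) (he : Fintype.card W * e = Fintype.card L + 1)
    (τ : L →+ ZMod p) (hτ : Function.Surjective τ) (ξ : Fin M ≃ X) :
    IsUnit (momentMatrix (Fintype.card L) e (Module.finrank L A)).det ∧
      (fun j : Fin (Module.finrank L A) =>
        (weightFrequency (Set.range fun (a : A) i => τ (f (ξ i) a)) (((p : ℚ) - 1) / p *
          ((Fintype.card L : ℚ) ^ 2 - (((j : ℕ) : ℚ) * e - 1) * Fintype.card L)) : ℚ)) =
        (momentMatrix (Fintype.card L) e (Module.finrank L A))⁻¹.mulVec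
          (momentVector (Fintype.card L) e (Module.finrank L A)) := by
  have := Fintype.ofFinite A
  have he0 : e ≠ 0 := by
    rintro rfl
    simp at he
  have hdet := isUnit_det_momentMatrix Fintype.card_ne_zero he0 (q := Fintype.card L)
    (Module.finrank L A)
  refine ⟨hdet, ?_⟩
  rw [← hg.momentMatrix_mulVec hW he, Matrix.mulVec_mulVec, Matrix.nonsing_inv_mul _ hdet,
    Matrix.one_mulVec]
  exact funext fun j => congrArg Nat.cast (H.weightFrequency_eq hg hW he τ hτ ξ j)

end IsRepetition

section QuadraticExtension

variable {L K : Type*} [Field L] [Field K] [Fintype L] [Algebra L K]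

theorem units_map_algebraMap_pow_card_sub_one (l : Lˣ) :
    Units.map (algebraMap L K : L →* K) l ^ (Fintype.card L - 1) = 1 := by
  classical
  rw [← map_pow, ← Fintype.card_units, pow_card_eq_one, map_one]

theorem exists_units_map_algebraMap_eq [Finite K] {κ : Kˣ} (hκ : κ ^ (Fintype.card L - 1) = 1) :
    ∃ l : Lˣ, Units.map (algebraMap L K : L →* K) l = κ := by
  classical
  have := Fintype.ofFinite K
  have hinj : Function.Injective (Units.map (algebraMap L K : L →* K)) :=
    Units.map_injective (algebraMap L K).injective
  have hsub : univ.image (Units.map (algebraMap L K : L →* K)) ⊆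
      ({κ | κ ^ (Fintype.card L - 1) = 1} : Finset Kˣ) := fun x hx => by
    obtain ⟨l, -, rfl⟩ := mem_image.1 hx
    exact mem_filter.2 ⟨mem_univ _, units_map_algebraMap_pow_card_sub_one l⟩
  have himage := eq_of_subset_of_card_le hsub <| by
    rw [card_image_of_injective _ hinj, card_univ, Fintype.card_units]
    exact IsCyclic.card_pow_eq_one_le (Nat.sub_pos_of_lt Fintype.one_lt_card)
  obtain ⟨l, -, hl⟩ := mem_image.1 (himage.symm ▸ mem_filter.2 ⟨mem_univ κ, hκ⟩)
  exact ⟨l, hl⟩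

theorem card_units_eq_mul (hLK : Module.finrank L K = 2) :
    Nat.card Kˣ = (Fintype.card L - 1) * (Fintype.card L + 1) := by
  have := Module.finite_of_finrank_eq_succ hLK
  rw [Nat.card_units, Module.natCard_eq_pow_finrank (K := L), hLK, Nat.card_eq_fintype_card,
    mul_comm, ← Nat.sq_sub_sq, one_pow]

theorem cast_card_units (hLK : Module.finrank L K = 2) :
    (Nat.card Kˣ : ℤ) = (Fintype.card L : ℤ) ^ 2 - 1 := by
  rw [card_units_eq_mul hLK]
  push_cast [Nat.cast_pred (R := ℤ) (Fintype.card_pos (α := L))]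
  ring

theorem units_zpow_eq_of_modEq (hLK : Module.finrank L K = 2) {a b : ℤ}
    (hab : a ≡ b [ZMOD (Fintype.card L : ℤ) ^ 2 - 1]) (x : Kˣ) : x ^ a = x ^ b := by
  rw [zpow_eq_zpow_iff_modEq]
  refine hab.of_dvd ?_
  rw [← cast_card_units hLK]
  exact_mod_cast orderOf_dvd_natCard x

variable (L K)

/-- The homomorphism `x ↦ x ^ ((q - 1) h)`, `q = #L`, of `Kˣ`, whose values are the nodes at which
the polynomials attached to the words of the codes are evaluated. -/
def nodeHom (h : ℕ) : Kˣ →* Kˣ :=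
  powMonoidHom ((Fintype.card L - 1) * h)

variable {L K}

theorem card_range_nodeHom_mul_gcd [Finite K] (hLK : Module.finrank L K = 2) (h : ℕ) :
    Nat.card (nodeHom L K h).range * Nat.gcd h (Fintype.card L + 1) = Fintype.card L + 1 := by
  rw [nodeHom, IsCyclic.card_powMonoidHom_range, card_units_eq_mul hLK,
    Nat.gcd_mul_left, Nat.mul_div_mul_left _ _ (Nat.sub_pos_of_lt Fintype.one_lt_card),
    Nat.gcd_comm (Fintype.card L + 1)]
  exact Nat.div_mul_cancel (Nat.gcd_dvd_right _ _)

theorem card_fiber_nodeHom [Fintype K] [DecidableEq K] (hLK : Module.finrank L K = 2) (h : ℕ)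
    (w : (nodeHom L K h).range) : #{x | (nodeHom L K h).rangeRestrict x = w} =
      Nat.gcd h (Fintype.card L + 1) * (Fintype.card L - 1) := by
  have hfib (w' : (nodeHom L K h).range) : #{x | (nodeHom L K h).rangeRestrict x = w'} =
      #{x | (nodeHom L K h).rangeRestrict x = w} :=
    MonoidHom.card_fiber_eq_of_mem_range _ ((nodeHom L K h).rangeRestrict_surjective w')
      ((nodeHom L K h).rangeRestrict_surjective w)
  have hcard := card_eq_sum_card_fiberwise (f := (nodeHom L K h).rangeRestrict) (s := univ)
    (t := univ) fun _ _ => mem_univ _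
  simp only [hfib, sum_const, card_univ, smul_eq_mul] at hcard
  refine Nat.eq_of_mul_eq_mul_left (Nat.card_pos (α := (nodeHom L K h).range)) ?_
  rw [← mul_assoc, card_range_nodeHom_mul_gcd hLK, Nat.card_eq_fintype_card, ← hcard,
    ← Nat.card_eq_fintype_card, card_units_eq_mul hLK, mul_comm]

variable {A : Type*} [AddCommGroup A] [Module L A] {h n : ℕ} {D : ℤ} {f : Kˣ → Module.Dual L A}
  {c : A → Fin n → K}

theorem apply_units_mul_eq_smul {Δ : ℕ} (hD : D ≡ Δ [ZMOD (Fintype.card L : ℤ) - 1])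
    (hf : ∀ x a, algebraMap L K (f x a) =
      (x ^ D : Kˣ) * ∑ m, c a m * (nodeHom L K h x : K) ^ (m : ℕ)) (l : Lˣ) (x : Kˣ) :
    f (Units.map (algebraMap L K : L →* K) l * x) = ((l ^ Δ : Lˣ) : L) • f x := by
  have hpow := units_map_algebraMap_pow_card_sub_one (K := K) l
  have hnode : nodeHom L K h (Units.map (algebraMap L K : L →* K) l) = 1 := by
    rw [nodeHom, powMonoidHom_apply, pow_mul, hpow, one_pow]
  have hzpow : Units.map (algebraMap L K : L →* K) l ^ D =
      Units.map (algebraMap L K : L →* K) (l ^ Δ) := by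
    rw [map_pow, ← zpow_natCast, zpow_eq_zpow_iff_modEq]
    refine hD.of_dvd ?_
    rw [← Nat.cast_pred Fintype.card_pos]
    exact_mod_cast orderOf_dvd_of_pow_eq_one hpow
  refine LinearMap.ext fun a => (algebraMap L K).injective ?_
  rw [LinearMap.smul_apply, smul_eq_mul, map_mul, hf, hf, map_mul, hnode, one_mul, mul_zpow, hzpow,
    Units.val_mul, Units.coe_map, MonoidHom.coe_coe, mul_assoc]

theorem isRepetition_nodeHom [Fintype K] [DecidableEq K] (hLK : Module.finrank L K = 2) {Δ : ℕ}
    (hΔ : Nat.Coprime Δ (Fintype.card L - 1)) (hD : D ≡ Δ [ZMOD (Fintype.card L : ℤ) - 1])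
    (hf : ∀ x a, algebraMap L K (f x a) =
      (x ^ D : Kˣ) * ∑ m, c a m * (nodeHom L K h x : K) ^ (m : ℕ))
    {rep : (nodeHom L K h).range → Kˣ} (hrep : ∀ w, (nodeHom L K h).rangeRestrict (rep w) = w) :
    IsRepetition (Nat.gcd h (Fintype.card L + 1)) (nodeHom L K h).rangeRestrict f
      fun w => f (rep w) where
  exists_perm_smul l := by
    classical
    have hco : (Nat.card Lˣ).Coprime Δ := by
      rw [Nat.card_eq_fintype_card, Fintype.card_units]
      exact hΔ.symm
    obtain ⟨l, rfl⟩ := (powCoprime hco).surjective l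
    exact ⟨Equiv.mulLeft (Units.map (algebraMap L K : L →* K) l), apply_units_mul_eq_smul hD hf l⟩
  apply_eq_zero_iff x a := by
    have hzero (y : Kˣ) : f y a = 0 ↔ ∑ m, c a m * (nodeHom L K h y : K) ^ (m : ℕ) = 0 := by
      rw [← map_eq_zero (algebraMap L K), hf, mul_eq_zero, or_iff_right (Units.ne_zero _)]
    have hnode : nodeHom L K h (rep ((nodeHom L K h).rangeRestrict x)) = nodeHom L K h x :=
      congrArg Subtype.val (hrep _)
    rw [hzero, hzero, hnode]
  card_fiber := card_fiber_nodeHom hLK h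

theorem isMDSFamily_nodeHom [DecidableEq L] [Fintype (nodeHom L K h).range]
    (hn : Module.finrank L A = n)
    (hf : ∀ x a, algebraMap L K (f x a) =
      (x ^ D : Kˣ) * ∑ m, c a m * (nodeHom L K h x : K) ^ (m : ℕ))
    (hc : ∀ a ≠ 0, c a ≠ 0) {rep : (nodeHom L K h).range → Kˣ}
    (hrep : ∀ w, (nodeHom L K h).rangeRestrict (rep w) = w) :
    IsMDSFamily fun w => f (rep w) := by
  intro a ha
  by_contra! hle
  rw [hn] at hle
  obtain ⟨S, hS, hcard⟩ := exists_subset_card_eq hle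
  let node (i : Fin n) : K :=
    (((S.equivFinOfCardEq hcard).symm i : (nodeHom L K h).range) : Kˣ)
  have hinj : Function.Injective node := fun i j hij =>
    (S.equivFinOfCardEq hcard).symm.injective (Subtype.ext (Subtype.ext (Units.ext hij)))
  refine hc a ha (Matrix.eq_zero_of_forall_index_sum_mul_pow_eq_zero hinj fun i => ?_)
  have hzero := (mem_filter.1 (hS ((S.equivFinOfCardEq hcard).symm i).2)).2
  have hnode := congrArg Subtype.val (hrep ((S.equivFinOfCardEq hcard).symm i))
  rw [MonoidHom.coe_rangeRestrict] at hnode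
  rw [← map_eq_zero (algebraMap L K), hf, mul_eq_zero, or_iff_right (Units.ne_zero _), hnode]
    at hzero
  exact hzero

theorem weightFrequency_eq_inv_mulVec_and_ncard_eq [Finite K] [Finite A] {Δ p M : ℕ}
    [Fact p.Prime] (hLK : Module.finrank L K = 2) (hΔ : Nat.Coprime Δ (Fintype.card L - 1))
    (hD : D ≡ Δ [ZMOD (Fintype.card L : ℤ) - 1]) (hn : Module.finrank L A = n)
    (hle : n ≤ Nat.card (nodeHom L K h).range)
    (hf : ∀ x a, algebraMap L K (f x a) =
      (x ^ D : Kˣ) * ∑ m, c a m * (nodeHom L K h x : K) ^ (m : ℕ))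
    (hc : ∀ a ≠ 0, c a ≠ 0) (τ : L →+ ZMod p) (hτ : Function.Surjective τ) (ξ : Fin M ≃ Kˣ)
    {e : ℕ} (he : e = Nat.gcd h (Fintype.card L + 1)) :
    IsUnit (momentMatrix (Fintype.card L) e n).det ∧
      (fun j : Fin n => (weightFrequency (Set.range fun (a : A) i => τ (f (ξ i) a))
        (((p : ℚ) - 1) / p *
          ((Fintype.card L : ℚ) ^ 2 - (((j : ℕ) : ℚ) * e - 1) * Fintype.card L)) : ℚ)) =
        (momentMatrix (Fintype.card L) e n)⁻¹.mulVec (momentVector (Fintype.card L) e n) ∧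
      ∀ r ≤ n, ({x : Fin r → Kˣ | ∑ k, f (x k) = 0}.ncard : ℚ) =
        powerSumN (Fintype.card L) e r := by
  classical
  have := Fintype.ofFinite K
  have := Fintype.ofFinite A
  subst he hn
  obtain ⟨rep, hrep⟩ := (nodeHom L K h).rangeRestrict_surjective.hasRightInverse
  have H := isRepetition_nodeHom hLK hΔ hD hf hrep
  have hg := isMDSFamily_nodeHom rfl hf hc hrep
  have hcard := card_range_nodeHom_mul_gcd hLK h
  rw [Nat.card_eq_fintype_card] at hle hcard
  obtain ⟨hdet, hfreq⟩ := H.weightFrequency_eq_inv_mulVec hg hle hcard τ hτ ξ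
  refine ⟨hdet, hfreq, fun r hr => ?_⟩
  rw [← H.card_sum_eq_zero hg hle hcard hr, ← Set.ncard_coe_finset, coe_filter_univ]

end QuadraticExtension

section TraceDual

variable (L : Type*) {K ι : Type*} [Field L] [Field K] [Algebra L K] [Fintype ι]

/-- The functional `a ↦ Tr (∑ j, a j * s j)` on `ι → K`, as a function of `s`; `Tr` is the trace
of `K` over `L`. -/
noncomputable def traceDual : (ι → K) →+ Module.Dual L (ι → K) :=
  AddMonoidHom.mk'
    (fun s => Algebra.trace L K ∘ₗ (Fintype.linearCombination K s).restrictScalars L)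
    fun s s' => LinearMap.ext fun a => by
      simp [Fintype.linearCombination_apply, mul_add, sum_add_distrib]

theorem traceDual_apply (s a : ι → K) :
    traceDual L s a = Algebra.trace L K (∑ j, a j * s j) :=
  rfl

theorem traceDual_injective [FiniteDimensional L K] [Algebra.IsSeparable L K] :
    Function.Injective (traceDual L : (ι → K) →+ Module.Dual L (ι → K)) := by
  classical
  refine (injective_iff_map_eq_zero _).2 fun s hs => funext fun j => ?_
  refine (traceForm_nondegenerate L K).2 _ fun z => ?_
  have hsingle := LinearMap.congr_fun hs (Pi.single j z)
  rwa [traceDual_apply, Fintype.sum_eq_single j fun i hi => by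
    rw [Pi.single_eq_of_ne hi, zero_mul], Pi.single_eq_same, LinearMap.zero_apply] at hsingle

/-- The functional `(a₀, a) ↦ a₀ * y + Tr (∑ j, a j * s j)` on `L × (ι → K)`, as a function of
`(y, s)`; `Tr` is the trace of `K` over `L`. -/
noncomputable def mulAddTraceDual : L × (ι → K) →+ Module.Dual L (L × (ι → K)) :=
  AddMonoidHom.mk' (fun u => (LinearMap.mulRight L u.1).coprod (traceDual L u.2)) fun u u' =>
    LinearMap.ext fun a => by
      simp only [LinearMap.coprod_apply, LinearMap.mulRight_apply, LinearMap.add_apply,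
        Prod.fst_add, Prod.snd_add, map_add, mul_add]
      ring

theorem mulAddTraceDual_apply (u a : L × (ι → K)) :
    mulAddTraceDual L u a = a.1 * u.1 + Algebra.trace L K (∑ j, a.2 j * u.2 j) :=
  rfl

theorem mulAddTraceDual_injective [FiniteDimensional L K] [Algebra.IsSeparable L K] :
    Function.Injective (mulAddTraceDual L : L × (ι → K) →+ Module.Dual L (L × (ι → K))) := by
  refine (injective_iff_map_eq_zero _).2 fun u hu => Prod.ext ?_ ?_
  · simpa [mulAddTraceDual_apply] using LinearMap.congr_fun hu (1, 0)
  · refine (map_eq_zero_iff _ (traceDual_injective L)).1 (LinearMap.ext fun a => ?_)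
    simpa [mulAddTraceDual_apply, traceDual_apply] using LinearMap.congr_fun hu (0, a)

end TraceDual

section PowerSums

variable {L K : Type*} [Field L] [Field K] [Fintype L] [Algebra L K] {h t : ℕ} {D : ℤ}

theorem algebraMap_trace_eq_pow_card_add (hLK : Module.finrank L K = 2) [Finite K] (z : K) :
    algebraMap L K (Algebra.trace L K z) = z ^ Fintype.card L + z := by
  rw [FiniteField.algebraMap_trace_eq_sum_pow, hLK, sum_range_succ, sum_range_one, pow_zero,
    pow_one, pow_one, Nat.card_eq_fintype_card, add_comm]

theorem zpow_eq_zpow_mul_nodeHom_pow (hLK : Module.finrank L K = 2) {a : ℤ} {k : ℕ}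
    (ha : a ≡ D + k * (h * ((Fintype.card L : ℤ) - 1)) [ZMOD (Fintype.card L : ℤ) ^ 2 - 1])
    (x : Kˣ) : x ^ a = x ^ D * nodeHom L K h x ^ k := by
  rw [units_zpow_eq_of_modEq hLK ha, zpow_add, nodeHom, powMonoidHom_apply, ← pow_mul,
    ← zpow_natCast x]
  push_cast [Nat.cast_pred (R := ℤ) (Fintype.card_pos (α := L))]
  ring_nf

theorem sum_mul_zpow_eq (hLK : Module.finrank L K = 2) {ι : Type*} [Fintype ι] {d : ι → ℤ}
    {k : ι → ℕ}
    (hd : ∀ j, d j ≡ D + k j * (h * ((Fintype.card L : ℤ) - 1))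
      [ZMOD (Fintype.card L : ℤ) ^ 2 - 1]) (b : ι → K) (x : Kˣ) :
    ∑ j, b j * (x ^ d j : Kˣ) = (x ^ D : Kˣ) * ∑ j, b j * (nodeHom L K h x : K) ^ k j := by
  rw [mul_sum]
  refine sum_congr rfl fun j _ => ?_
  rw [zpow_eq_zpow_mul_nodeHom_pow hLK (hd j), Units.val_mul, Units.val_pow_eq_pow_val,
    mul_left_comm]

theorem sum_mul_zpow_pow_card_eq (hLK : Module.finrank L K = 2) {d : Fin t → ℤ}
    (hd : ∀ j, (Fintype.card L : ℤ) * d j ≡ D + (j.rev : ℕ) * (h * ((Fintype.card L : ℤ) - 1))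
      [ZMOD (Fintype.card L : ℤ) ^ 2 - 1]) (a : Fin t → K) (x : Kˣ) :
    (∑ j, a j * (x ^ d j : Kˣ)) ^ Fintype.card L =
      (x ^ D : Kˣ) * ∑ j : Fin t, a j.rev ^ Fintype.card L * (nodeHom L K h x : K) ^ (j : ℕ) := by
  have hfrob : (∑ j, a j * (x ^ d j : Kˣ)) ^ Fintype.card L =
      ∑ j, a j ^ Fintype.card L * (x ^ ((Fintype.card L : ℤ) * d j) : Kˣ) := by
    refine (map_sum (FiniteField.frobeniusAlgHom L K) _ _).trans (sum_congr rfl fun j _ => ?_)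
    simp only [FiniteField.coe_frobeniusAlgHom]
    rw [mul_pow, ← Units.val_pow_eq_pow_val, mul_comm _ (d j),
      zpow_mul, zpow_natCast]
  rw [hfrob, sum_mul_zpow_eq hLK hd]
  exact congrArg _ (Fintype.sum_equiv Fin.revPerm _ _ fun j => by
    rw [Fin.revPerm_apply, Fin.rev_rev])

end PowerSums

section Exponents

variable {p q h Δ t n : ℕ}

theorem IsHalf.two_mul_modEq {n u : ℤ} (hu : IsHalf p q n u) : 2 * u ≡ n [ZMOD (q : ℤ) + 1] := by
  unfold IsHalf at hu
  split_ifs at hu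
  · exact hu
  · rw [hu]

theorem IsHalf.modEq {n u u' : ℤ} (hq : p = 2 → Even q) (hu : IsHalf p q n u)
    (hu' : IsHalf p q n u') : u ≡ u' [ZMOD (q : ℤ) + 1] := by
  by_cases hp : p = 2
  · have hodd : IsCoprime ((q : ℤ) + 1) 2 :=
      Int.isCoprime_two_right.2 ((Int.even_coe_nat q).2 (hq hp)).add_one
    have hdvd := (hu.two_mul_modEq.trans hu'.two_mul_modEq.symm).dvd
    rw [← mul_sub] at hdvd
    exact Int.modEq_iff_dvd.2 (hodd.dvd_of_dvd_mul_left hdvd)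
  · unfold IsHalf at hu hu'
    rw [if_neg hp] at hu hu'
    rw [show u = u' by omega]

theorem mul_sub_one_modEq {s s' : ℤ} (hs : s ≡ s' [ZMOD (q : ℤ) + 1]) :
    s * ((q : ℤ) - 1) ≡ s' * ((q : ℤ) - 1) [ZMOD (q : ℤ) ^ 2 - 1] := by
  rw [show (q : ℤ) ^ 2 - 1 = ((q : ℤ) + 1) * (q - 1) by ring]
  exact hs.mul_right'

theorem mul_modEq_conj {a s s' : ℤ} (ha : a ≡ s * ((q : ℤ) - 1) + Δ [ZMOD (q : ℤ) ^ 2 - 1])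
    (hs : s + s' ≡ Δ [ZMOD (q : ℤ) + 1]) :
    q * a ≡ s' * ((q : ℤ) - 1) + Δ [ZMOD (q : ℤ) ^ 2 - 1] := by
  obtain ⟨y, hy⟩ := ha.dvd
  obtain ⟨z, hz⟩ := (mul_sub_one_modEq hs).dvd
  exact Int.modEq_iff_dvd.2 ⟨q * y - s - z, by linear_combination (q : ℤ) * hy - hz⟩

-- Modulo `q ^ 2 - 1` the numbers `q * d (n - 1), …, q * d 0` and `d 0, …, d (n - 1)` lie in one
-- progression with difference `(q - 1) h`; for `n = t` the second list continues the first, for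
-- `n = t + 1` they overlap in `q * d 0 ≡ d 0`.
theorem exists_modEq_of_two_mul_modEq {d : Fin n → ℤ} {u : ℤ}
    (hu : 2 * u ≡ Δ + (t + 1 - n) * h [ZMOD (q : ℤ) + 1])
    (hd : ∀ j : Fin n, ∃ s : ℤ, s ≡ (j : ℕ) * h + u [ZMOD (q : ℤ) + 1] ∧
      d j ≡ s * ((q : ℤ) - 1) + Δ [ZMOD (q : ℤ) ^ 2 - 1]) :
    ∃ D : ℤ, D ≡ Δ [ZMOD (q : ℤ) - 1] ∧
      (∀ j, (q : ℤ) * d j ≡ D + (j.rev : ℕ) * (h * ((q : ℤ) - 1)) [ZMOD (q : ℤ) ^ 2 - 1]) ∧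
      ∀ j, d j ≡ D + (t + (j : ℕ) : ℕ) * (h * ((q : ℤ) - 1)) [ZMOD (q : ℤ) ^ 2 - 1] := by
  refine ⟨(u - t * h) * ((q : ℤ) - 1) + Δ, Int.modEq_iff_dvd.2 ⟨t * h - u, by ring⟩,
    fun j => ?_, fun j => ?_⟩
  · obtain ⟨s, hs, hdj⟩ := hd j
    have hrev : ((j.rev : ℕ) : ℤ) = n - (j + 1) := by
      rw [Fin.val_rev]
      omega
    refine (mul_modEq_conj (s' := u - t * h + (j.rev : ℕ) * h) hdj ?_).trans ?_
    · obtain ⟨y, hy⟩ := hu.dvd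
      obtain ⟨z, hz⟩ := hs.dvd
      exact Int.modEq_iff_dvd.2 ⟨y + z, by rw [hrev]; linear_combination hy + hz⟩
    · exact Int.modEq_iff_dvd.2 ⟨0, by ring⟩
  · obtain ⟨s, hs, hdj⟩ := hd j
    refine (hdj.trans ((mul_sub_one_modEq hs).add_right _)).trans ?_
    exact Int.modEq_iff_dvd.2 ⟨0, by push_cast; ring⟩

theorem IsExponentsOne.exists_modEq (hq : p = 2 → Even q) {d : Fin (t + 1) → ℤ}
    (hd : IsExponentsOne p q h Δ d) : ∃ D : ℤ, D ≡ Δ [ZMOD (q : ℤ) - 1] ∧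
      (∀ j, (q : ℤ) * d j ≡ D + (j.rev : ℕ) * (h * ((q : ℤ) - 1)) [ZMOD (q : ℤ) ^ 2 - 1]) ∧
      ∀ j, d j ≡ D + (t + (j : ℕ) : ℕ) * (h * ((q : ℤ) - 1)) [ZMOD (q : ℤ) ^ 2 - 1] := by
  obtain ⟨-, u, hu, -⟩ := hd 0
  refine exists_modEq_of_two_mul_modEq (u := u) ?_ fun j => ?_
  · simpa using hu.two_mul_modEq
  · obtain ⟨s, u', hu', hs, hdj⟩ := hd j
    exact ⟨s, hs.trans ((hu'.modEq hq hu).add_left _), hdj⟩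

theorem IsExponentsTwo.exists_modEq (hq : p = 2 → Even q) (ht : 0 < t) {d : Fin t → ℤ}
    (hd : IsExponentsTwo p q h Δ d) : ∃ D : ℤ, D ≡ Δ [ZMOD (q : ℤ) - 1] ∧
      (∀ j, (q : ℤ) * d j ≡ D + (j.rev : ℕ) * (h * ((q : ℤ) - 1)) [ZMOD (q : ℤ) ^ 2 - 1]) ∧
      ∀ j, d j ≡ D + (t + (j : ℕ) : ℕ) * (h * ((q : ℤ) - 1)) [ZMOD (q : ℤ) ^ 2 - 1] := by
  obtain ⟨-, u, hu, -⟩ := hd ⟨0, ht⟩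
  refine exists_modEq_of_two_mul_modEq (u := u + h) ?_ fun j => ?_
  · obtain ⟨y, hy⟩ := hu.two_mul_modEq.dvd
    exact Int.modEq_iff_dvd.2 ⟨y, by linear_combination hy⟩
  · obtain ⟨s, u', hu', hs, hdj⟩ := hd j
    refine ⟨s, (hs.trans ((hu'.modEq hq hu).add_left _)).trans ?_, hdj⟩
    exact Int.modEq_iff_dvd.2 ⟨0, by ring⟩

end Exponents

section Codes

variable {p : ℕ} {L K : Type*} [Field L] [Field K] [Algebra L K] {h Δ t : ℕ}

theorem exists_equiv_units_eq_pow [Finite K] {n : ℕ} (hK : Nat.card K = n) {γ : Kˣ}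
    (hγ : ∀ x : Kˣ, x ∈ Subgroup.zpowers γ) :
    ∃ ξ : Fin (n - 1) ≃ Kˣ, ∀ i, ξ i = γ ^ (i : ℕ) := by
  have hord : n - 1 = orderOf γ := by
    rw [orderOf_eq_card_of_forall_mem_zpowers hγ, Nat.card_units, hK]
  exact ⟨(finCongr hord).trans
    ((finEquivZPowers (isOfFinOrder_of_finite γ)).trans (Equiv.subtypeUnivEquiv hγ)),
    fun i => rfl⟩

variable [Finite K]

section Words

variable [Finite L]

theorem sum_traceDual_zpow_eq_zero_iff (d : Fin t → ℤ) {r : ℕ} (x : Fin r → Kˣ) :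
    ∑ k, traceDual L (fun j => ((x k ^ d j : Kˣ) : K)) = 0 ↔
      ∀ j, ∑ k, ((x k ^ d j : Kˣ) : K) = 0 := by
  rw [← map_sum, map_eq_zero_iff _ (traceDual_injective L), funext_iff]
  simp only [Finset.sum_apply, Pi.zero_apply]

theorem sum_mulAddTraceDual_zpow_eq_zero_iff {d : Fin (t + 1) → ℤ} {y : Kˣ → L}
    (hy : ∀ x, algebraMap L K (y x) = (x ^ d 0 : Kˣ)) {r : ℕ} (x : Fin r → Kˣ) :
    ∑ k, mulAddTraceDual L (y (x k), fun j : Fin t => ((x k ^ d j.succ : Kˣ) : K)) = 0 ↔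
      ∀ j, ∑ k, ((x k ^ d j : Kˣ) : K) = 0 := by
  rw [← map_sum, map_eq_zero_iff _ (mulAddTraceDual_injective L), Prod.ext_iff, Prod.fst_sum,
    Prod.snd_sum, Fin.forall_fin_succ, Prod.fst_zero, Prod.snd_zero, funext_iff]
  simp only [← hy, ← map_sum, map_eq_zero, Finset.sum_apply, Pi.zero_apply]

variable [Fact p.Prime] [Algebra (ZMod p) L] [Algebra (ZMod p) K]

theorem nihoCodeTwo_eq_range {q : ℕ} {γ : Kˣ} {ξ : Fin (q ^ 2 - 1) ≃ Kˣ}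
    (hξ : ∀ i, ξ i = γ ^ (i : ℕ)) (d : Fin t → ℤ) :
    nihoCodeTwo p q K γ d = Set.range fun a i => (Algebra.trace (ZMod p) L).toAddMonoidHom
      (traceDual L (fun j => ((ξ i ^ d j : Kˣ) : K)) a) := by
  have : IsScalarTower (ZMod p) L K := IsScalarTower.of_algebraMap_eq' (Subsingleton.elim _ _)
  ext u
  simp only [nihoCodeTwo, Set.mem_ofPred_eq, Set.mem_range, funext_iff, traceDual_apply,
    LinearMap.toAddMonoidHom_coe, Algebra.trace_trace, hξ, ← zpow_natCast, ← zpow_mul,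
    mul_comm (d _), eq_comm]

theorem nihoCodeOne_eq_range {q : ℕ} {γ : Kˣ} {ξ : Fin (q ^ 2 - 1) ≃ Kˣ}
    (hξ : ∀ i, ξ i = γ ^ (i : ℕ)) {d : Fin (t + 1) → ℤ} {y : Kˣ → L}
    (hy : ∀ x, algebraMap L K (y x) = (x ^ d 0 : Kˣ)) :
    nihoCodeOne p q L K γ d = Set.range fun a i => (Algebra.trace (ZMod p) L).toAddMonoidHom
      (mulAddTraceDual L (y (ξ i), fun j : Fin t => ((ξ i ^ d j.succ : Kˣ) : K)) a) := by
  have : IsScalarTower (ZMod p) L K := IsScalarTower.of_algebraMap_eq' (Subsingleton.elim _ _)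
  have hpow (j : Fin (t + 1)) (i : Fin (q ^ 2 - 1)) : γ ^ (d j * (i : ℤ)) = ξ i ^ d j := by
    rw [hξ, mul_comm, zpow_mul, zpow_natCast]
  have hword (a₀ : L) (i : Fin (q ^ 2 - 1)) (z : L) :
      algebraMap L K z = algebraMap L K a₀ * ((ξ i ^ d 0 : Kˣ) : K) ↔
        z = a₀ * y (ξ i) := by
    rw [← hy, ← map_mul, (algebraMap L K).injective.eq_iff]
  ext u
  simp only [nihoCodeOne, Set.mem_ofPred_eq, Set.mem_range, funext_iff, mulAddTraceDual_apply,
    LinearMap.toAddMonoidHom_coe, map_add, Algebra.trace_trace, hpow, hword, exists_eq_left,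
    Prod.exists, eq_comm]

end Words

variable [Fintype L]

theorem algebraMap_traceDual_zpow (hLK : Module.finrank L K = 2) {D : ℤ}
    {d : Fin t → ℤ}
    (hrev : ∀ j, (Fintype.card L : ℤ) * d j ≡ D + (j.rev : ℕ) * (h * ((Fintype.card L : ℤ) - 1))
      [ZMOD (Fintype.card L : ℤ) ^ 2 - 1])
    (hadd : ∀ j, d j ≡ D + (t + (j : ℕ) : ℕ) * (h * ((Fintype.card L : ℤ) - 1))
      [ZMOD (Fintype.card L : ℤ) ^ 2 - 1]) (x : Kˣ) (a : Fin t → K) :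
    algebraMap L K (traceDual L (fun j => ((x ^ d j : Kˣ) : K)) a) =
      (x ^ D : Kˣ) * ∑ m, Fin.append (fun j => a j.rev ^ Fintype.card L) a m *
        (nodeHom L K h x : K) ^ (m : ℕ) := by
  simp only [Fin.sum_univ_add, Fin.append_left, Fin.append_right, Fin.val_castAdd, Fin.val_natAdd]
  rw [traceDual_apply, algebraMap_trace_eq_pow_card_add hLK, sum_mul_zpow_pow_card_eq hLK hrev,
    sum_mul_zpow_eq hLK hadd, mul_add]

theorem algebraMap_mulAddTraceDual_zpow (hLK : Module.finrank L K = 2) {D : ℤ}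
    {d : Fin (t + 1) → ℤ}
    (hrev : ∀ j, (Fintype.card L : ℤ) * d j ≡ D + (j.rev : ℕ) * (h * ((Fintype.card L : ℤ) - 1))
      [ZMOD (Fintype.card L : ℤ) ^ 2 - 1])
    (hadd : ∀ j, d j ≡ D + (t + (j : ℕ) : ℕ) * (h * ((Fintype.card L : ℤ) - 1))
      [ZMOD (Fintype.card L : ℤ) ^ 2 - 1]) {x : Kˣ} {y : L}
    (hy : algebraMap L K y = (x ^ d 0 : Kˣ)) (a : L × (Fin t → K)) :
    algebraMap L K (mulAddTraceDual L (y, fun j => ((x ^ d j.succ : Kˣ) : K)) a) =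
      (x ^ D : Kˣ) * ∑ m, Fin.append (fun j => a.2 j.rev ^ Fintype.card L)
        (Fin.cons (algebraMap L K a.1) a.2 : Fin (t + 1) → K) m *
          (nodeHom L K h x : K) ^ (m : ℕ) := by
  have hrev' (j : Fin t) : (Fintype.card L : ℤ) * d j.succ ≡
      D + (j.rev : ℕ) * (h * ((Fintype.card L : ℤ) - 1)) [ZMOD (Fintype.card L : ℤ) ^ 2 - 1] := by
    simpa only [Fin.rev_succ, Fin.val_castSucc] using hrev j.succ
  have hsum := sum_mul_zpow_eq hLK hadd (Fin.cons (algebraMap L K a.1) a.2 : Fin (t + 1) → K) x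
  rw [Fin.sum_univ_succ] at hsum
  simp only [Fin.cons_zero, Fin.cons_succ] at hsum
  rw [Fin.sum_univ_add]
  simp only [Fin.append_left, Fin.append_right, Fin.val_castAdd, Fin.val_natAdd]
  rw [mulAddTraceDual_apply, map_add, algebraMap_trace_eq_pow_card_add hLK,
    sum_mul_zpow_pow_card_eq hLK hrev', mul_add, ← hsum, map_mul, hy]
  ring

theorem exists_algebraMap_eq_zpow (hLK : Module.finrank L K = 2) {a : ℤ}
    (ha : (Fintype.card L : ℤ) * a ≡ a [ZMOD (Fintype.card L : ℤ) ^ 2 - 1]) (x : Kˣ) :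
    ∃ y : L, algebraMap L K y = (x ^ a : Kˣ) := by
  have hpow : (x ^ a) ^ (Fintype.card L - 1) = 1 := by
    rw [← zpow_natCast, ← zpow_mul, Nat.cast_pred Fintype.card_pos, mul_sub, mul_one, mul_comm,
      zpow_sub, units_zpow_eq_of_modEq hLK ha, mul_inv_cancel]
  obtain ⟨l, hl⟩ := exists_units_map_algebraMap_eq hpow
  exact ⟨l, congrArg Units.val hl⟩

variable [Fact p.Prime] [Algebra (ZMod p) L] [Algebra (ZMod p) K]

theorem nihoCodeTwo_weightFrequency_and_powerSumCount (hLK : Module.finrank L K = 2) {γ : Kˣ}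
    (hγ : ∀ x : Kˣ, x ∈ Subgroup.zpowers γ) (hΔ : Nat.Coprime Δ (Fintype.card L - 1))
    (hq : p = 2 → Even (Fintype.card L)) {e : ℕ} (he : e = Nat.gcd h (Fintype.card L + 1))
    (ht : 0 < t) (hle : t + t ≤ Nat.card (nodeHom L K h).range) {d : Fin t → ℤ}
    (hd : IsExponentsTwo p (Fintype.card L) h Δ d) :
    IsUnit (momentMatrix (Fintype.card L) e (t + t)).det ∧
      (fun j : Fin (t + t) => (weightFrequency (nihoCodeTwo p (Fintype.card L) K γ d)
        (((p : ℚ) - 1) / p *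
          ((Fintype.card L : ℚ) ^ 2 - (((j : ℕ) : ℚ) * e - 1) * Fintype.card L)) : ℚ)) =
        (momentMatrix (Fintype.card L) e (t + t))⁻¹.mulVec
          (momentVector (Fintype.card L) e (t + t)) ∧
      ∀ r ≤ t + t, (powerSumCount K d r : ℚ) = powerSumN (Fintype.card L) e r := by
  obtain ⟨ξ, hξ⟩ := exists_equiv_units_eq_pow (n := Fintype.card L ^ 2)
    (by rw [Module.natCard_eq_pow_finrank (K := L), hLK, Nat.card_eq_fintype_card]) hγ
  obtain ⟨D, hD, hrev, hadd⟩ := hd.exists_modEq hq ht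
  have hrank : Module.finrank L (Fin t → K) = t + t := by
    simp only [Module.finrank_pi_fintype, hLK, sum_const, card_univ, Fintype.card_fin, smul_eq_mul,
      mul_two]
  have hmain := weightFrequency_eq_inv_mulVec_and_ncard_eq hLK hΔ hD hrank hle
    (algebraMap_traceDual_zpow hLK hrev hadd)
    (fun a => mt fun hc => funext fun j =>
      (Fin.append_right _ _ j).symm.trans (congrFun hc (Fin.natAdd t j)))
    (Algebra.trace (ZMod p) L).toAddMonoidHom (Algebra.trace_surjective (ZMod p) L) ξ he
  simp only [sum_traceDual_zpow_eq_zero_iff] at hmain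
  rwa [← nihoCodeTwo_eq_range hξ] at hmain

theorem nihoCodeOne_weightFrequency_and_powerSumCount (hLK : Module.finrank L K = 2) {γ : Kˣ}
    (hγ : ∀ x : Kˣ, x ∈ Subgroup.zpowers γ) (hΔ : Nat.Coprime Δ (Fintype.card L - 1))
    (hq : p = 2 → Even (Fintype.card L)) {e : ℕ} (he : e = Nat.gcd h (Fintype.card L + 1))
    (hle : t + (t + 1) ≤ Nat.card (nodeHom L K h).range) {d : Fin (t + 1) → ℤ}
    (hd : IsExponentsOne p (Fintype.card L) h Δ d) :
    IsUnit (momentMatrix (Fintype.card L) e (t + (t + 1))).det ∧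
      (fun j : Fin (t + (t + 1)) => (weightFrequency (nihoCodeOne p (Fintype.card L) L K γ d)
        (((p : ℚ) - 1) / p *
          ((Fintype.card L : ℚ) ^ 2 - (((j : ℕ) : ℚ) * e - 1) * Fintype.card L)) : ℚ)) =
        (momentMatrix (Fintype.card L) e (t + (t + 1)))⁻¹.mulVec
          (momentVector (Fintype.card L) e (t + (t + 1))) ∧
      ∀ r ≤ t + (t + 1), (powerSumCount K d r : ℚ) = powerSumN (Fintype.card L) e r := by
  obtain ⟨ξ, hξ⟩ := exists_equiv_units_eq_pow (n := Fintype.card L ^ 2)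
    (by rw [Module.natCard_eq_pow_finrank (K := L), hLK, Nat.card_eq_fintype_card]) hγ
  obtain ⟨D, hD, hrev, hadd⟩ := hd.exists_modEq hq
  choose y hy using exists_algebraMap_eq_zpow hLK (hrev 0 |>.trans (hadd 0).symm)
  have hrank : Module.finrank L (L × (Fin t → K)) = t + (t + 1) := by
    simp only [Module.finrank_prod, Module.finrank_self, Module.finrank_pi_fintype, hLK, sum_const,
      card_univ, Fintype.card_fin, smul_eq_mul]
    ring
  have hc (a : L × (Fin t → K)) (hc : Fin.append (fun j => a.2 j.rev ^ Fintype.card L)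
      (Fin.cons (algebraMap L K a.1) a.2 : Fin (t + 1) → K) = 0) : a = 0 :=
    Prod.ext
      ((map_eq_zero (algebraMap L K)).1
        ((Fin.append_right _ _ 0).symm.trans (congrFun hc (Fin.natAdd t 0))))
      (funext fun j =>
        (Fin.append_right _ _ j.succ).symm.trans (congrFun hc (Fin.natAdd t j.succ)))
  have hmain := weightFrequency_eq_inv_mulVec_and_ncard_eq hLK hΔ hD hrank hle
    (fun x => algebraMap_mulAddTraceDual_zpow hLK hrev hadd (hy x)) (fun a => mt (hc a))
    (Algebra.trace (ZMod p) L).toAddMonoidHom (Algebra.trace_surjective (ZMod p) L) ξ he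
  simp only [sum_mulAddTraceDual_zpow_eq_zero_iff hy] at hmain
  rwa [← nihoCodeOne_eq_range hξ hy] at hmain

end Codes

theorem finrank_eq_two_of_natCard_eq_sq {L K : Type*} [Field L] [Field K] [Fintype L] [Finite K]
    [Algebra L K] (hK : Nat.card K = Fintype.card L ^ 2) : Module.finrank L K = 2 := by
  rw [Module.natCard_eq_pow_finrank (K := L), Nat.card_eq_fintype_card] at hK
  exact Nat.pow_right_injective (Fintype.one_lt_card (α := L)) hK

theorem add_self_le_of_mul_eq {q e t w : ℕ} (hw : w * e = q + 1)
    (ht : (t : ℚ) ≤ ((q : ℚ) + 1) / (2 * e)) : t + t ≤ w := by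
  have he : 0 < e := Nat.pos_of_ne_zero (by rintro rfl; omega)
  rw [le_div_iff₀ (by positivity)] at ht
  have hte : (t + t) * e ≤ w * e := by
    rw [hw, ← two_mul, mul_comm 2 t, mul_assoc]
    exact_mod_cast ht
  exact Nat.le_of_mul_le_mul_right hte he

theorem add_self_succ_le_of_mul_eq {q e t w : ℕ} (hq : Even q) (hw : w * e = q + 1)
    (ht : (t : ℚ) ≤ ((q : ℚ) + 1) / (2 * e)) : t + (t + 1) ≤ w := by
  have hodd : Odd (w * e) := hw ▸ hq.add_one
  have hne : t + t ≠ w := fun h =>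
    Nat.not_even_iff_odd.2 (Nat.odd_mul.1 hodd).1 (h ▸ Even.add_self t)
  exact Nat.lt_of_le_of_ne (add_self_le_of_mul_eq hw ht) hne

theorem theorem2 (p m : ℕ) [Fact p.Prime] (hm : 0 < m) (q : ℕ) (hq : q = p ^ m)
    (L K : Type*) [Field L] [Field K] [Algebra L K] [Algebra (ZMod p) L] [Algebra (ZMod p) K]
    (hL : Nat.card L = q) (hK : Nat.card K = q ^ 2)
    (γ : Kˣ) (hγ : ∀ x : Kˣ, x ∈ Subgroup.zpowers γ)
    (h Δ : ℕ) (hh : 0 < h) (hΔ : 0 < Δ) (hhq : ¬ q + 1 ∣ h) (hΔq : Nat.Coprime Δ (q - 1))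
    (e : ℕ) (he : e = Nat.gcd h (q + 1)) :
    (p = 2 → ∀ (t : ℕ), (t : ℚ) ≤ ((q : ℚ) + 1) / (2 * e) →
      ∀ d : Fin (t + 1) → ℤ, IsExponentsOne p q h Δ d →
        IsUnit (momentMatrix q e (2 * t + 1)).det ∧
        (fun j : Fin (2 * t + 1) => (weightFrequency (nihoCodeOne p q L K γ d)
            (((q : ℚ) ^ 2 - (((j : ℕ) : ℚ) * e - 1) * q) / 2) : ℚ)) =
          Matrix.mulVec (momentMatrix q e (2 * t + 1))⁻¹ (momentVector q e (2 * t + 1)) ∧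
        ∀ r ≤ 2 * t + 1, (powerSumCount K d r : ℚ) = powerSumN q e r) ∧
    (∀ (t : ℕ), 1 ≤ t → (t : ℚ) ≤ ((q : ℚ) + 1) / (2 * e) → (p ≠ 2 → Odd h) →
      ∀ d : Fin t → ℤ, IsExponentsTwo p q h Δ d →
        IsUnit (momentMatrix q e (2 * t)).det ∧
        (fun j : Fin (2 * t) => (weightFrequency (nihoCodeTwo p q K γ d)
            (((p : ℚ) - 1) / p * ((q : ℚ) ^ 2 - (((j : ℕ) : ℚ) * e - 1) * q)) : ℚ)) =
          Matrix.mulVec (momentMatrix q e (2 * t))⁻¹ (momentVector q e (2 * t)) ∧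
        ∀ r ≤ 2 * t, (powerSumCount K d r : ℚ) = powerSumN q e r) := by
  have : Finite L := Nat.finite_of_card_ne_zero (by rw [hL, hq]; exact NeZero.ne _)
  have : Finite K := Nat.finite_of_card_ne_zero (by rw [hK, ← hL]; exact NeZero.ne _)
  have := Fintype.ofFinite L
  obtain rfl : Fintype.card L = q := by rw [← hL, Nat.card_eq_fintype_card]
  have hLK := finrank_eq_two_of_natCard_eq_sq hK
  have hW := he ▸ card_range_nodeHom_mul_gcd hLK h
  have heven (h2 : p = 2) : Even (Fintype.card L) := hq ▸ h2 ▸ even_two.pow_of_ne_zero hm.ne'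
  refine ⟨fun h2 t ht d hd => ?_, fun t ht1 ht _ d hd => ?_⟩
  · have hhalf (w : ℚ) : w / 2 = ((p : ℚ) - 1) / p * w := by
      rw [h2]
      push_cast
      ring
    simp only [hhalf]
    rw [two_mul, add_assoc]
    exact nihoCodeOne_weightFrequency_and_powerSumCount hLK hγ hΔq heven he
      (add_self_succ_le_of_mul_eq (heven h2) hW ht) hd
  · rw [two_mul]
    exact nihoCodeTwo_weightFrequency_and_powerSumCount hLK hγ hΔq heven he ht1
      (add_self_le_of_mul_eq hW ht) hd
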